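/- Let $k$ be an algebraically closed field and let $A$ and $B$ be finite-dimensional symmetric $k$-algebras; that is, $A\cong A^*$ as $(A,A)$-bimodules and $B\cong B^*$ as $(B,B)$-bimodules, where $(-)^*=\operatorname{Hom}_k(-,k)$. Let $M$ be a finite-dimensional $(A,B)$-bimodule (with $k$ acting in the same way through $A$ and through $B$) that is projective as a left $A$-module and as a right $B$-module, and regard $M^*=\operatorname{Hom}_k(M,k)$ as a $(B,A)$-bimodule by $(bfa)(m)=f(amb)$ for $f\in M^*$, $a\in A$, $b\in B$, $m\in M$. Then for every simple right $A$-module $S$ and every simple right $B$-module $T$, with projective covers $P(S)$ and $P(T)$, $$[P(T)\,|\,S\otimes_A M]^B=[P(S)\,|\,T\otimes_B M^*]^A ,$$ and this common value is finite. Here, for a projective right $A$-module $P$ and a right $A$-module $U$, $[P\,|\,U]^A$ denotes the multiplicity of $P$ as a direct summand of $U$, i.e. the largest integer $n\ge 0$ such that $P^n$ is isomorphic to a direct summand of $U$ (and $\infty$ if there is no largest such $n$); similarly for $B$. -/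

import Mathlib

open scoped TensorProduct
open MulOpposite

/-! Right modules over `R` are modules over `Rᵐᵒᵖ`: the right action `x · r` is `op r • x`.
A bimodule over two `k`-algebras `A` and `B` is a left `A`-module and right `B`-module on which the
two actions commute and both restrict to the same action of `k`. -/

section BalancedTensor

variable (k A : Type*) [CommRing k] [Ring A]
variable (S M : Type*) [AddCommGroup S] [Module k S] [Module Aᵐᵒᵖ S]
  [AddCommGroup M] [Module k M] [Module A M]

/-- The relations `(s · a) ⊗ m = s ⊗ (a · m)`, as a submodule of `S ⊗[k] M`. -/
def balancedRel : Submodule k (S ⊗[k] M) :=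
  Submodule.span k {z | ∃ (s : S) (a : A) (m : M), z = (op a • s) ⊗ₜ[k] m - s ⊗ₜ[k] (a • m)}

/-- The tensor product `S ⊗_A M` of a right `A`-module `S` and a left `A`-module `M`, where `A` is a
`k`-algebra: the quotient of `S ⊗[k] M` by the relations `(s · a) ⊗ m = s ⊗ (a · m)`. -/
def BalancedTensor : Type _ := (S ⊗[k] M) ⧸ balancedRel k A S M

noncomputable instance : AddCommGroup (BalancedTensor k A S M) :=
  inferInstanceAs (AddCommGroup ((S ⊗[k] M) ⧸ balancedRel k A S M))

noncomputable instance : Module k (BalancedTensor k A S M) :=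
  inferInstanceAs (Module k ((S ⊗[k] M) ⧸ balancedRel k A S M))

/-- The elementary tensor `s ⊗ m` in `S ⊗_A M`. -/
def BalancedTensor.tmul {S M : Type*} [AddCommGroup S] [Module k S] [Module Aᵐᵒᵖ S]
    [AddCommGroup M] [Module k M] [Module A M] (s : S) (m : M) : BalancedTensor k A S M :=
  Submodule.Quotient.mk (p := balancedRel k A S M) (s ⊗ₜ[k] m)

variable {S M} in
theorem BalancedTensor.tmul_add (s : S) (m n : M) :
    tmul k A s (m + n) = tmul k A s m + tmul k A s n :=
  congrArg (Submodule.Quotient.mk (p := balancedRel k A S M)) (TensorProduct.tmul_add s m n)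

variable {S} in
theorem BalancedTensor.tmul_zero (s : S) : tmul k A s (0 : M) = 0 :=
  congrArg (Submodule.Quotient.mk (p := balancedRel k A S M)) (TensorProduct.tmul_zero M s)

variable (B : Type*) [Ring B] [Module Bᵐᵒᵖ M] [SMulCommClass Bᵐᵒᵖ k M] [SMulCommClass A Bᵐᵒᵖ M]

theorem balancedRel_le_comap (b : Bᵐᵒᵖ) : balancedRel k A S M ≤
    (balancedRel k A S M).comap ((Module.toModuleEnd k (S := Bᵐᵒᵖ) M b).lTensor S) := by
  refine Submodule.span_le.2 ?_
  rintro _ ⟨s, a, m, rfl⟩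
  refine Submodule.subset_span ⟨s, a, b • m, ?_⟩
  simp [smul_comm a b m]

/-- The right action of `b` on `S ⊗_A M`, induced by `s ⊗ m ↦ s ⊗ (m · b)`. -/
def BalancedTensor.rightMul (b : Bᵐᵒᵖ) :
    BalancedTensor k A S M →ₗ[k] BalancedTensor k A S M :=
  (balancedRel k A S M).mapQ (balancedRel k A S M)
    ((Module.toModuleEnd k (S := Bᵐᵒᵖ) M b).lTensor S) (balancedRel_le_comap k A S M B b)

variable {k A S M} in
theorem BalancedTensor.hom_ext {f g : BalancedTensor k A S M →ₗ[k] BalancedTensor k A S M}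
    (h : ∀ s m, f (tmul k A s m) = g (tmul k A s m)) : f = g := by
  refine Submodule.linearMap_qext (balancedRel k A S M) (TensorProduct.ext' fun s m => ?_)
  exact h s m

theorem BalancedTensor.rightMul_tmul (b : Bᵐᵒᵖ) (s : S) (m : M) :
    rightMul k A S M B b (tmul k A s m) = tmul k A s (b • m) := rfl

/-- For an `(A, B)`-bimodule `M`, the right `B`-module structure `(s ⊗ m) · b = s ⊗ (m · b)`
on `S ⊗_A M`. -/
noncomputable instance : Module Bᵐᵒᵖ (BalancedTensor k A S M) where
  smul b z := BalancedTensor.rightMul k A S M B b z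
  one_smul z := by
    have : BalancedTensor.rightMul k A S M B 1 = LinearMap.id :=
      BalancedTensor.hom_ext fun s m => by simp [BalancedTensor.rightMul_tmul]
    exact LinearMap.congr_fun this z
  mul_smul b c z := by
    have : BalancedTensor.rightMul k A S M B (b * c) =
        BalancedTensor.rightMul k A S M B b ∘ₗ BalancedTensor.rightMul k A S M B c :=
      BalancedTensor.hom_ext fun s m => by simp [BalancedTensor.rightMul_tmul, mul_smul]
    exact LinearMap.congr_fun this z
  smul_zero b := map_zero (BalancedTensor.rightMul k A S M B b)
  smul_add b := map_add (BalancedTensor.rightMul k A S M B b)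
  add_smul b c z := by
    have : BalancedTensor.rightMul k A S M B (b + c) =
        BalancedTensor.rightMul k A S M B b + BalancedTensor.rightMul k A S M B c :=
      BalancedTensor.hom_ext fun s m => by
        rw [LinearMap.add_apply]
        simp only [BalancedTensor.rightMul_tmul, add_smul, BalancedTensor.tmul_add]
    exact LinearMap.congr_fun this z
  zero_smul z := by
    have : BalancedTensor.rightMul k A S M B 0 = 0 :=
      BalancedTensor.hom_ext fun s m => by
        rw [LinearMap.zero_apply]
        simp only [BalancedTensor.rightMul_tmul, zero_smul, BalancedTensor.tmul_zero]
    exact LinearMap.congr_fun this z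

variable {k A S M B} in
theorem BalancedTensor.op_smul_tmul (b : B) (s : S) (m : M) :
    op b • tmul k A s m = tmul k A s (op b • m) := rfl

end BalancedTensor

section DualBimodule

variable (k M : Type*) [CommRing k] [AddCommGroup M] [Module k M]

/-- The `k`-dual `M* = Hom_k(M, k)` of a bimodule, a copy of `Module.Dual k M` that carries the
contragredient actions `(b · f · a)(m) = f (a · m · b)`. -/
def DualBimodule : Type _ := Module.Dual k M

instance : AddCommGroup (DualBimodule k M) := inferInstanceAs (AddCommGroup (Module.Dual k M))

instance : Module k (DualBimodule k M) := inferInstanceAs (Module k (Module.Dual k M))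

instance : FunLike (DualBimodule k M) M k := inferInstanceAs (FunLike (Module.Dual k M) M k)

variable {k M}

@[ext] theorem DualBimodule.ext {f g : DualBimodule k M} (h : ∀ m, f m = g m) : f = g :=
  DFunLike.ext f g h

variable {A B : Type*} [Ring A] [Ring B] [Module A M] [SMulCommClass A k M]
  [Module Bᵐᵒᵖ M] [SMulCommClass Bᵐᵒᵖ k M]

/-- The left action `(b · f)(m) = f (m · b)`. -/
instance DualBimodule.leftModule : Module B (DualBimodule k M) where
  smul b f := LinearMap.comp (σ₁₂ := RingHom.id k) (M₃ := k) f
    (Module.toModuleEnd k (S := Bᵐᵒᵖ) M (op b))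
  one_smul f := DualBimodule.ext fun m => congrArg f (one_smul Bᵐᵒᵖ m)
  mul_smul b c f := DualBimodule.ext fun m => congrArg f (mul_smul (op c) (op b) m)
  smul_zero _ := rfl
  smul_add _ _ _ := rfl
  add_smul b c f := DualBimodule.ext fun m =>
    (congrArg f (add_smul (op b) (op c) m)).trans (LinearMap.map_add (M₃ := k) f _ _)
  zero_smul f := DualBimodule.ext fun m =>
    (congrArg f (zero_smul Bᵐᵒᵖ m)).trans (LinearMap.map_zero (M₃ := k) f)

/-- The right action `(f · a)(m) = f (a · m)`. -/
instance DualBimodule.rightModule : Module Aᵐᵒᵖ (DualBimodule k M) where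
  smul a f := LinearMap.comp (σ₁₂ := RingHom.id k) (M₃ := k) f
    (Module.toModuleEnd k (S := A) M (unop a))
  one_smul f := DualBimodule.ext fun m => congrArg f (one_smul A m)
  mul_smul a c f := DualBimodule.ext fun m => congrArg f (mul_smul (unop c) (unop a) m)
  smul_zero _ := rfl
  smul_add _ _ _ := rfl
  add_smul a c f := DualBimodule.ext fun m =>
    (congrArg f (add_smul (unop a) (unop c) m)).trans (LinearMap.map_add (M₃ := k) f _ _)
  zero_smul f := DualBimodule.ext fun m =>
    (congrArg f (zero_smul A m)).trans (LinearMap.map_zero (M₃ := k) f)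

theorem DualBimodule.smul_apply (b : B) (f : DualBimodule k M) (m : M) :
    (b • f) m = f (op b • m) := rfl

theorem DualBimodule.op_smul_apply (a : A) (f : DualBimodule k M) (m : M) :
    (op a • f) m = f (a • m) := rfl

instance [SMulCommClass A Bᵐᵒᵖ M] : SMulCommClass B Aᵐᵒᵖ (DualBimodule k M) where
  smul_comm b a f := DualBimodule.ext fun m => congrArg f (smul_comm (unop a) (op b) m)

instance : SMulCommClass Aᵐᵒᵖ k (DualBimodule k M) where
  smul_comm _ _ _ := rfl

end DualBimodule

/-- A `k`-algebra `A` is symmetric if `A ≅ A*` as `(A, A)`-bimodules. -/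
def IsBimoduleSymmetric (k A : Type*) [CommRing k] [Ring A] [Algebra k A] : Prop :=
  ∃ e : A ≃ₗ[A] DualBimodule k A, ∀ a x : A, e (x * a) = op a • e x

/-- `f : P → U` is a projective cover: `P` is projective, `f` is surjective, and the kernel of `f`
is superfluous in `P`. -/
structure IsProjectiveCover {R P U : Type*} [Ring R] [AddCommGroup P] [Module R P]
    [AddCommGroup U] [Module R U] (f : P →ₗ[R] U) : Prop where
  projective : Module.Projective R P
  surjective : Function.Surjective f
  superfluous : ∀ N : Submodule R P, N ⊔ LinearMap.ker f = ⊤ → N = ⊤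

/-- `P ^ n` is isomorphic to a direct summand of `U`. -/
def IsPowSummand (R P U : Type*) [Ring R] [AddCommGroup P] [Module R P]
    [AddCommGroup U] [Module R U] (n : ℕ) : Prop :=
  ∃ X Y : Submodule R U, IsCompl X Y ∧ Nonempty ((Fin n → P) ≃ₗ[R] X)

/-- The multiplicity `[P | U]` of `P` as a direct summand of `U`: the largest `n` such that `P ^ n`
is isomorphic to a direct summand of `U` (`⊤` if there is no largest one). -/
noncomputable def summandMultiplicity (R P U : Type*) [Ring R] [AddCommGroup P] [Module R P]
    [AddCommGroup U] [Module R U] : ℕ∞ :=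
  ⨆ (n : ℕ) (_ : IsPowSummand R P U n), (n : ℕ∞)

/-! A symmetrizing form `τ` on `R` embeds a simple module `S` in `R`: a nonzero functional `θ` on
`S` gives `c : S → R` with `τ (c s * r) = θ (r • s)`. For `s ≠ 0` put `z = c s`. Then `z` kills
every `U` without a summand `P(S)`, and `z P(S)` is a line, so `[P(S) | U] = dim z U`
(`summandMultiplicity_eq_finrank`). Since `M` is projective over `A`, `S ⊗_A M` embeds in `M` with
image `z_S M`, so `[P(T) | S ⊗_A M]` is the rank of `m ↦ z_S m z_T` on `M`
(`finrank_range_toModuleEnd`). As `M*` is projective over `B` (`DualBimodule.projective`), the other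
multiplicity is likewise the rank of the transpose of that map on `M*`, and the two ranks agree. -/

section Summands

/-! ### Powers of a module as retracts. -/

variable {R P U : Type*} [Ring R] [AddCommGroup P] [Module R P] [AddCommGroup U] [Module R U]

theorem isPowSummand_iff_exists_retraction {n : ℕ} :
    IsPowSummand R P U n ↔
      ∃ (i : (Fin n → P) →ₗ[R] U) (r : U →ₗ[R] (Fin n → P)), ∀ v, r (i v) = v := by
  constructor
  · rintro ⟨X, Y, h, ⟨e⟩⟩
    refine ⟨X.subtype ∘ₗ e.toLinearMap, e.symm.toLinearMap ∘ₗ X.projectionOnto Y h, fun v => ?_⟩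
    simp
  · rintro ⟨i, r, h⟩
    have hi : Function.Injective i := Function.LeftInverse.injective h
    let e := LinearEquiv.ofInjective i hi
    refine ⟨LinearMap.range i, LinearMap.ker (e.toLinearMap ∘ₗ r),
      LinearMap.isCompl_of_proj ?_, ⟨e⟩⟩
    rintro ⟨_, v, rfl⟩
    ext
    simp [h, e]

/-- If `P ^ n` is a retract of the kernel of a split surjection `U → P`, then `P ^ (n + 1)` is a
retract of `U`. -/
theorem IsPowSummand.succ_of_ker {n : ℕ} (r : U →ₗ[R] P) (i : P →ₗ[R] U) (hri : ∀ p, r (i p) = p)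
    (h : IsPowSummand R P (LinearMap.ker r) n) : IsPowSummand R P U (n + 1) := by
  rw [isPowSummand_iff_exists_retraction] at h ⊢
  obtain ⟨j, s, hsj⟩ := h
  let q : U →ₗ[R] LinearMap.ker r :=
    (LinearMap.id - i ∘ₗ r).codRestrict (LinearMap.ker r) fun u => by simp [hri]
  have hq : ∀ (p : P) (y : LinearMap.ker r), q (i p + y) = y := fun p y => by
    ext
    simp [q, hri]
  refine ⟨i ∘ₗ LinearMap.proj 0 +
      (LinearMap.ker r).subtype ∘ₗ j ∘ₗ LinearMap.pi fun m => LinearMap.proj m.succ,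
    LinearMap.pi (Fin.cons r fun m => LinearMap.proj m ∘ₗ s ∘ₗ q), fun v => ?_⟩
  funext m
  refine Fin.cases ?_ (fun m => ?_) m
  · simp [hri]
  · simp [hq, hsj]

end Summands

/-! ### Symmetrizing forms and the embedding of simple modules. -/

/-- A linear form on a `k`-algebra `R` is symmetrizing if it is symmetric and
`x ↦ (r ↦ τ (x * r))` is a bijection of `R` with its dual. -/
structure IsSymmetrizingForm {k R : Type*} [CommRing k] [Ring R] [Algebra k R]
    (τ : R →ₗ[k] k) : Prop where
  map_mul_comm : ∀ x y, τ (x * y) = τ (y * x)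
  exists_eq : ∀ f : R →ₗ[k] k, ∃ x, ∀ r, f r = τ (x * r)
  eq_zero : ∀ x, (∀ r, τ (x * r) = 0) → x = 0

theorem IsBimoduleSymmetric.exists_isSymmetrizingForm {k A : Type*} [CommRing k] [Ring A]
    [Algebra k A] (h : IsBimoduleSymmetric k A) : ∃ τ : A →ₗ[k] k, IsSymmetrizingForm τ := by
  obtain ⟨e, he⟩ := h
  let τ : A →ₗ[k] k := e 1
  have hl : ∀ x r, (e x) r = τ (r * x) := fun x r => by
    have : e x = x • e 1 := by rw [← map_smul, smul_eq_mul, mul_one]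
    rw [this]; rfl
  have hr : ∀ x r, (e x) r = τ (x * r) := fun x r => by
    have : e x = op x • e 1 := by rw [← he, one_mul]
    rw [this]; rfl
  refine ⟨τ, fun x y => by rw [← hr, hl], fun f => ?_, fun x hx => ?_⟩
  · obtain ⟨x, hx⟩ := e.surjective f
    exact ⟨x, fun r => by rw [← hr, hx]; rfl⟩
  · refine e.map_eq_zero_iff.1 (DualBimodule.ext fun r => ?_)
    rw [hr, hx]; rfl

namespace IsSymmetrizingForm

variable {k R : Type*} [Field k] [Ring R] [Algebra k R] {τ : R →ₗ[k] k}

theorem op (h : IsSymmetrizingForm τ) :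
    IsSymmetrizingForm (τ ∘ₗ (MulOpposite.opLinearEquiv k).symm.toLinearMap) where
  map_mul_comm x y := h.map_mul_comm _ _
  exists_eq f := by
    obtain ⟨x, hx⟩ := h.exists_eq (f ∘ₗ (MulOpposite.opLinearEquiv k).toLinearMap)
    refine ⟨MulOpposite.op x, fun r => ?_⟩
    exact (hx r.unop).trans (h.map_mul_comm _ _)
  eq_zero x hx := unop_injective (h.eq_zero _ fun r =>
    (h.map_mul_comm _ _).trans (hx (MulOpposite.op r)))

variable {U : Type*} [AddCommGroup U] [Module k U] [Module R U] [IsScalarTower k R U]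

/-- The `R`-linear map `c : U → R` with `τ (c u * r) = f (r • u)`. -/
noncomputable def dualHom (h : IsSymmetrizingForm τ) (f : U →ₗ[k] k) : U →ₗ[R] R :=
  have spec : ∀ u : U, ∃ x, ∀ r : R, f (r • u) = τ (x * r) := fun u =>
    h.exists_eq (f ∘ₗ (LinearMap.toSpanSingleton R U u).restrictScalars k)
  have ext : ∀ x y : R, (∀ r, τ (x * r) = τ (y * r)) → x = y := fun x y hxy =>
    sub_eq_zero.1 (h.eq_zero _ fun r => by rw [sub_mul, map_sub, hxy, sub_self])
  { toFun := fun u => (spec u).choose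
    map_add' := fun u v => ext _ _ fun r => by
      rw [add_mul, map_add, ← (spec _).choose_spec, ← (spec _).choose_spec,
        ← (spec _).choose_spec, smul_add, map_add]
    map_smul' := fun s u => ext _ _ fun r => by
      rw [RingHom.id_apply, smul_eq_mul, mul_assoc, h.map_mul_comm s, mul_assoc,
        ← (spec _).choose_spec, ← (spec _).choose_spec, mul_smul] }

theorem dualHom_spec (h : IsSymmetrizingForm τ) (f : U →ₗ[k] k) (u : U) (r : R) :
    τ (h.dualHom f u * r) = f (r • u) :=
  (Exists.choose_spec (p := fun x => ∀ r : R, f (r • u) = τ (x * r)) _ r).symm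

/-- The map is zero or injective by simplicity, and `r = 1` recovers `f` as `τ ∘ c`. -/
theorem dualHom_injective (h : IsSymmetrizingForm τ) [IsSimpleModule R U] {f : U →ₗ[k] k}
    (hf : f ≠ 0) : Function.Injective (h.dualHom f) := by
  refine (LinearMap.injective_or_eq_zero _).resolve_right fun h0 => hf ?_
  ext u
  have := h.dualHom_spec f u 1
  rw [h0] at this
  simpa using this.symm

variable {S : Type*} [AddCommGroup S] [Module k S] [Module R S] [IsScalarTower k R S]

/-- `τ` turns the evaluation of `f` on `z • u`, with `z = c_θ s`, into the evaluation of `θ`. -/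
theorem apply_dualHom_smul (h : IsSymmetrizingForm τ) (θ : S →ₗ[k] k) (s : S) (f : U →ₗ[k] k)
    (u : U) : f (h.dualHom θ s • u) = θ (h.dualHom f u • s) := by
  rw [← h.dualHom_spec, h.map_mul_comm, h.dualHom_spec]

end IsSymmetrizingForm

/-! ### Multiplicity of a projective cover as a rank. -/

namespace IsProjectiveCover

variable {R P S : Type*} [Ring R] [AddCommGroup P] [Module R P] [AddCommGroup S] [Module R S]
  {π : P →ₗ[R] S}

theorem surjective_of_comp {U : Type*} [AddCommGroup U] [Module R U] (hπ : IsProjectiveCover π)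
    (g : U →ₗ[R] P) (h : Function.Surjective (π ∘ₗ g)) : Function.Surjective g := by
  refine LinearMap.range_eq_top.1 (hπ.superfluous _ (eq_top_iff.2 fun p _ => ?_))
  obtain ⟨u, hu⟩ := h (π p)
  refine Submodule.mem_sup.2 ⟨g u, ⟨u, rfl⟩, p - g u, ?_, by abel⟩
  rw [LinearMap.mem_ker, map_sub, ← hu]
  simp

/-- A maximal submodule not containing `ker π` would span `P` together with it, against superfluity.
-/
theorem ker_le_of_isSimpleModule [IsSimpleModule R S] (hπ : IsProjectiveCover π)
    (g : P →ₗ[R] S) : LinearMap.ker π ≤ LinearMap.ker g := by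
  by_cases hg : LinearMap.ker g = ⊤
  · rw [hg]; exact le_top
  · have hc := LinearMap.isCoatom_ker_of_surjective hπ.surjective
    have hc' := LinearMap.isCoatom_ker_of_surjective
      (LinearMap.surjective_of_ne_zero fun h0 => hg (LinearMap.ker_eq_top.2 h0) : Function.Surjective g)
    by_contra hle
    exact hg (hπ.superfluous _ (hc'.2 _ (lt_of_le_of_ne le_sup_left fun he =>
      hle (he ▸ le_sup_right))))

variable {k : Type*} [Field k] [Algebra k R] [Module k S] [IsScalarTower k R S]
  [IsSimpleModule R S] {τ : R →ₗ[k] k} {θ : S →ₗ[k] k} {s : S}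

variable {U : Type*} [AddCommGroup U] [Module k U] [Module R U] [IsScalarTower k R U]

/-- If `f (z • u) ≠ 0`, then `u ↦ c_f u • s` is a nonzero map `U → S` factoring through `R`. It
lifts to `P`; the lift is onto because `π` is a cover, and splits because `P` is projective. -/
theorem exists_retraction_of_dualHom_smul_ne_zero (hπ : IsProjectiveCover π)
    (h : IsSymmetrizingForm τ) {u : U} (hu : h.dualHom θ s • u ≠ 0) :
    ∃ (r : U →ₗ[R] P) (i : P →ₗ[R] U), ∀ p, r (i p) = p := by
  have := hπ.projective
  obtain ⟨f, hf⟩ : ∃ f : U →ₗ[k] k, f (h.dualHom θ s • u) ≠ 0 := by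
    by_contra! h0
    exact hu ((Module.forall_dual_apply_eq_zero_iff k _).1 h0)
  obtain ⟨β, hβ⟩ := Module.projective_lifting_property π (LinearMap.toSpanSingleton R S s)
    hπ.surjective
  have hr : Function.Surjective (β ∘ₗ h.dualHom f) := by
    refine hπ.surjective_of_comp _ ?_
    rw [← LinearMap.comp_assoc, hβ]
    refine LinearMap.surjective_of_ne_zero fun h0 => hf ?_
    rw [h.apply_dualHom_smul]
    have := LinearMap.congr_fun h0 u
    simp only [LinearMap.comp_apply, LinearMap.toSpanSingleton_apply] at this
    rw [this]
    simp
  obtain ⟨i, hi⟩ := Module.projective_lifting_property _ LinearMap.id hr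
  exact ⟨β ∘ₗ h.dualHom f, i, LinearMap.congr_fun hi⟩

variable [IsAlgClosed k] [FiniteDimensional k S]

/-- Every such `g` factors through `π`, and Schur's lemma over `k` makes the induced endomorphism of
`S` a scalar. -/
theorem exists_eq_smul_of_isSimpleModule (hπ : IsProjectiveCover π)
    (g : P →ₗ[R] S) : ∃ c : k, ∀ p, g p = c • π p := by
  let g' : S →ₗ[R] S := (LinearMap.ker π).liftQ g (hπ.ker_le_of_isSimpleModule g) ∘ₗ
    (π.quotKerEquivOfSurjective hπ.surjective).symm.toLinearMap
  obtain ⟨c, hc⟩ := (IsSimpleModule.algebraMap_end_bijective_of_isAlgClosed (A := R) (V := S) k).2 g'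
  refine ⟨c, fun p => ?_⟩
  have h1 : g' (π p) = g p := by
    have : (π.quotKerEquivOfSurjective hπ.surjective).symm (π p) = Submodule.Quotient.mk p := by
      rw [LinearEquiv.symm_apply_eq]; rfl
    simp [g', this]
  rw [← h1, ← hc]
  simp

variable [Module k P] [IsScalarTower k R P]

/-- That is, `z P` is a line. For every functional `f`, `f (z • p) = θ (c_f p • s)`, and `p ↦ c_f p
• s` is a multiple of `π`; hence `z • p` depends only on `θ (π p)`. -/
theorem exists_dualHom_smul_eq (hπ : IsProjectiveCover π) (h : IsSymmetrizingForm τ) (hθ : θ ≠ 0)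
    (hs : s ≠ 0) : ∃ p₀ : P, h.dualHom θ s • p₀ ≠ 0 ∧
      ∀ p : P, ∃ c : k, h.dualHom θ s • p = c • h.dualHom θ s • p₀ := by
  obtain ⟨t, ht⟩ : ∃ t, θ t ≠ 0 := by
    by_contra! h0
    exact hθ (LinearMap.ext h0)
  obtain ⟨p₁, rfl⟩ := hπ.surjective t
  have hker : ∀ p, θ (π p) = 0 → h.dualHom θ s • p = 0 := fun p hp => by
    refine (Module.forall_dual_apply_eq_zero_iff k _).1 fun f => ?_
    obtain ⟨c, hc⟩ := hπ.exists_eq_smul_of_isSimpleModule (k := k)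
      (LinearMap.toSpanSingleton R S s ∘ₗ h.dualHom f)
    have := hc p
    simp only [LinearMap.comp_apply, LinearMap.toSpanSingleton_apply] at this
    rw [h.apply_dualHom_smul, this, map_smul, hp, smul_zero]
  refine ⟨p₁, fun h0 => ht ?_, fun p => ⟨θ (π p) / θ (π p₁), ?_⟩⟩
  -- Lifting `π` to `α : P → R` gives `θ (π p₁) = τ (z * α p₁) = τ (α (z • p₁))`, so `z • p₁ = 0`
  -- would force `θ (π p₁) = 0`.
  · have := hπ.projective
    obtain ⟨α, hα⟩ := Module.projective_lifting_property (LinearMap.toSpanSingleton R S s) π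
      (IsSimpleModule.toSpanSingleton_surjective R hs)
    have hα' : α p₁ • s = π p₁ := LinearMap.congr_fun hα p₁
    rw [← hα', ← h.dualHom_spec, ← smul_eq_mul (a := h.dualHom θ s), ← map_smul, h0, map_zero, map_zero]
  · have := hker (p - (θ (π p) / θ (π p₁)) • p₁) (by
      rw [map_sub, map_sub, LinearMap.map_smul_of_tower, map_smul, smul_eq_mul,
        div_mul_cancel₀ _ ht, sub_self])
    rw [smul_sub, sub_eq_zero] at this
    rw [this, smul_comm]

theorem isPowSummand_of_le_finrank [FiniteDimensional k U] (hπ : IsProjectiveCover π)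
    (h : IsSymmetrizingForm τ) (hθ : θ ≠ 0) (hs : s ≠ 0) (n : ℕ)
    (hn : n ≤ Module.finrank k (LinearMap.range (Module.toModuleEnd k (S := R) U (h.dualHom θ s)))) :
    IsPowSummand R P U n := by
  induction n generalizing U with
  | zero => exact isPowSummand_iff_exists_retraction.2 ⟨0, 0, fun v => Subsingleton.elim _ _⟩
  | succ n ih =>
    set z := h.dualHom θ s with hz
    obtain ⟨u, hu⟩ : ∃ u : U, z • u ≠ 0 := by
      by_contra! h0
      have : Module.toModuleEnd k (S := R) U z = 0 := LinearMap.ext h0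
      rw [this, LinearMap.range_zero, finrank_bot] at hn
      omega
    obtain ⟨r, i, hri⟩ := hπ.exists_retraction_of_dualHom_smul_ne_zero h hu
    obtain ⟨p₀, -, hp₀⟩ := hπ.exists_dualHom_smul_eq h hθ hs
    refine IsPowSummand.succ_of_ker r i hri ?_
    let K := LinearMap.ker r
    have : FiniteDimensional k K :=
      inferInstanceAs (FiniteDimensional k (K.restrictScalars k))
    refine ih (U := K) ?_
    let W := LinearMap.range (Module.toModuleEnd k (S := R) K z)
    let incl : K →ₗ[k] U := K.subtype.restrictScalars k
    -- Splitting off one copy of `P` lowers `dim z U` by at most one, since `z P` is spanned by `z •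
    -- p₀`.
    have hle : LinearMap.range (Module.toModuleEnd k (S := R) U z) ≤
        W.map incl ⊔ Submodule.span k {z • i p₀} := by
      rintro _ ⟨u, rfl⟩
      obtain ⟨c, hc⟩ := hp₀ (r u)
      refine Submodule.mem_sup.2 ⟨z • (u - i (r u)), ?_, z • i (r u), ?_, ?_⟩
      · exact ⟨_, ⟨⟨u - i (r u), by simp [K, hri]⟩, rfl⟩, rfl⟩
      · refine Submodule.mem_span_singleton.2 ⟨c, ?_⟩
        rw [← map_smul i, ← map_smul i, hc, LinearMap.map_smul_of_tower i c]
      · rw [smul_sub, sub_add_cancel]; rfl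
    have h1 := Submodule.finrank_mono hle
    have h2 := Submodule.finrank_add_le_finrank_add_finrank (W.map incl)
      (Submodule.span k {z • i p₀})
    have h3 := Submodule.finrank_map_le incl W
    have h4 : Module.finrank k (Submodule.span k {z • i p₀}) ≤ 1 := by
      simpa using finrank_span_le_card (R := k) {z • i p₀}
    change n ≤ Module.finrank k W
    omega

theorem le_finrank_of_isPowSummand [FiniteDimensional k U] (hπ : IsProjectiveCover π)
    (h : IsSymmetrizingForm τ) (hθ : θ ≠ 0) (hs : s ≠ 0) {n : ℕ} (hn : IsPowSummand R P U n) :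
    n ≤ Module.finrank k
      (LinearMap.range (Module.toModuleEnd k (S := R) U (h.dualHom θ s))) := by
  obtain ⟨i, r, hri⟩ := isPowSummand_iff_exists_retraction.1 hn
  obtain ⟨p₀, hp₀, -⟩ := hπ.exists_dualHom_smul_eq h hθ hs
  -- One copy of `p₀` in each summand; multiplication by `z` keeps these independent.
  let g : (Fin n → k) →ₗ[k] U := (i.restrictScalars k) ∘ₗ
    LinearMap.pi fun m => (LinearMap.proj m : (Fin n → k) →ₗ[k] k).smulRight p₀
  have hg : Function.Injective (Module.toModuleEnd k (S := R) U (h.dualHom θ s) ∘ₗ g) := by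
    refine (injective_iff_map_eq_zero _).2 fun a ha => ?_
    have ha' : h.dualHom θ s • i (fun m => a m • p₀) = 0 := ha
    have := congrArg r ha'
    rw [map_smul, hri, map_zero] at this
    funext m
    have := congrFun this m
    rw [Pi.smul_apply, smul_comm] at this
    exact (smul_eq_zero.1 this).resolve_right hp₀
  have := LinearMap.finrank_range_of_inj hg
  rw [Module.finrank_fin_fun] at this
  rw [← this]
  exact Submodule.finrank_mono (LinearMap.range_comp_le_range _ _)

theorem summandMultiplicity_eq_finrank [FiniteDimensional k U] (hπ : IsProjectiveCover π)
    (h : IsSymmetrizingForm τ) (hθ : θ ≠ 0) (hs : s ≠ 0) :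
    summandMultiplicity R P U = (Module.finrank k
      (LinearMap.range (Module.toModuleEnd k (S := R) U (h.dualHom θ s))) : ℕ∞) := by
  refine le_antisymm (iSup₂_le fun n hn => ?_) ?_
  · exact_mod_cast hπ.le_finrank_of_isPowSummand h hθ hs hn
  · exact le_iSup₂ (f := fun (n : ℕ) (_ : IsPowSummand R P U n) => (n : ℕ∞)) _
      (hπ.isPowSummand_of_le_finrank h hθ hs _ le_rfl)

end IsProjectiveCover

/-! ### Tensoring a simple right ideal with a projective module. -/

theorem Module.Projective.exists_finite_dualBasis (R M : Type*) [Ring R] [AddCommGroup M]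
    [Module R M] [Module.Finite R M] (h : Module.Projective R M) :
    ∃ (d : ℕ) (n : Fin d → M) (c : Fin d → (M →ₗ[R] R)), ∀ x, ∑ i, c i x • n i = x := by
  obtain ⟨d, f, g, -, -, hfg⟩ := Module.Finite.exists_comp_eq_id_of_projective R M
  refine ⟨d, fun i => f fun j => if i = j then 1 else 0, fun i => LinearMap.proj i ∘ₗ g, fun x => ?_⟩
  conv_rhs => rw [← LinearMap.id_apply (R := R) x, ← hfg, LinearMap.comp_apply,
    LinearMap.pi_apply_eq_sum_univ f]
  rfl

namespace BalancedTensor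

section Lift

variable {k A : Type*} [CommRing k] [Ring A]
variable {S M V : Type*} [AddCommGroup S] [Module k S] [Module Aᵐᵒᵖ S]
  [AddCommGroup M] [Module k M] [Module A M] [AddCommGroup V] [Module k V]

theorem linearMap_ext {f g : BalancedTensor k A S M →ₗ[k] V}
    (h : ∀ s m, f (tmul k A s m) = g (tmul k A s m)) : f = g :=
  Submodule.linearMap_qext (balancedRel k A S M) (TensorProduct.ext' fun s m => h s m)

/-- The linear map on `S ⊗_A M` induced by a balanced bilinear map. -/
noncomputable def lift (f : S →ₗ[k] M →ₗ[k] V) (hf : ∀ s (a : A) m, f (op a • s) m = f s (a • m)) :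
    BalancedTensor k A S M →ₗ[k] V :=
  (balancedRel k A S M).liftQ (TensorProduct.lift f) (Submodule.span_le.2 (by
    rintro _ ⟨s, a, m, rfl⟩
    simp [hf]))

@[simp] theorem lift_tmul (f : S →ₗ[k] M →ₗ[k] V)
    (hf : ∀ s (a : A) m, f (op a • s) m = f s (a • m)) (s : S) (m : M) :
    lift f hf (tmul k A s m) = f s m := rfl

theorem smul_tmul (s : S) (a : A) (m : M) :
    tmul k A (op a • s) m = tmul k A s (a • m) :=
  (Submodule.Quotient.eq _).2 (Submodule.subset_span ⟨s, a, m, rfl⟩)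

variable (k A M) in
/-- The map `s ↦ s ⊗ m`. -/
noncomputable def mkRight (m : M) : S →ₗ[k] BalancedTensor k A S M :=
  (balancedRel k A S M).mkQ ∘ₗ (TensorProduct.mk k S M).flip m

theorem mkRight_apply (m : M) (s : S) : mkRight k A M m s = tmul k A s m := rfl

instance [Module.Finite k S] [Module.Finite k M] : Module.Finite k (BalancedTensor k A S M) :=
  inferInstanceAs (Module.Finite k ((S ⊗[k] M) ⧸ balancedRel k A S M))

instance {B : Type*} [Ring B] [Algebra k B] [Module Bᵐᵒᵖ M] [IsScalarTower k Bᵐᵒᵖ M]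
    [SMulCommClass A Bᵐᵒᵖ M] : IsScalarTower k Bᵐᵒᵖ (BalancedTensor k A S M) where
  smul_assoc c b w := by
    have : rightMul k A S M B (c • b) = c • rightMul k A S M B b :=
      linearMap_ext fun s m => by
        rw [LinearMap.smul_apply, rightMul_tmul, rightMul_tmul, smul_assoc]
        exact congrArg (Submodule.Quotient.mk (p := balancedRel k A S M))
          (TensorProduct.tmul_smul c s (b • m))
    exact LinearMap.congr_fun this w

end Lift

variable {k A : Type*} [Field k] [Ring A] [Algebra k A]
variable {S M : Type*} [AddCommGroup S] [Module k S] [Module Aᵐᵒᵖ S] [IsScalarTower k Aᵐᵒᵖ S]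
  [AddCommGroup M] [Module k M] [Module A M] [IsScalarTower k A M]

/-- The map `s ⊗ m ↦ ι s · m` on `S ⊗_A M`, for a homomorphism `ι : S → A` of right
`A`-modules. -/
noncomputable def toModule (M : Type*) [AddCommGroup M] [Module k M] [Module A M] [IsScalarTower k A M]
    (ι : S →ₗ[Aᵐᵒᵖ] Aᵐᵒᵖ) : BalancedTensor k A S M →ₗ[k] M :=
  lift (LinearMap.mk₂ k (fun s m => unop (ι s) • m)
    (fun s t m => by rw [map_add, unop_add, add_smul])
    (fun c s m => by rw [LinearMap.map_smul_of_tower, unop_smul, smul_assoc])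
    (fun s m n => smul_add _ _ _)
    (fun c s m => smul_comm _ _ _))
    (fun s a m => by
      rw [LinearMap.mk₂_apply, LinearMap.mk₂_apply, map_smul, smul_eq_mul, unop_mul, unop_op,
        mul_smul])

theorem toModule_tmul (ι : S →ₗ[Aᵐᵒᵖ] Aᵐᵒᵖ) (s : S) (m : M) :
    toModule M ι (tmul k A s m) = unop (ι s) • m := rfl

/-- Flatness made explicit by a dual basis: with `γ i (s ⊗ m) = s · c i m`, every `w` equals `∑ γ i
w ⊗ n i`, while `ι (γ i w)` is `c i` of the image of `w`. -/
theorem toModule_injective {d : ℕ} (n : Fin d → M) (c : Fin d → (M →ₗ[A] A))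
    (hn : ∀ x, ∑ i, c i x • n i = x) {ι : S →ₗ[Aᵐᵒᵖ] Aᵐᵒᵖ} (hι : Function.Injective ι) :
    Function.Injective (toModule (k := k) M ι) := by
  let γ : Fin d → (BalancedTensor k A S M →ₗ[k] S) := fun i =>
    lift (LinearMap.mk₂ k (fun s m => op (c i m) • s)
      (fun s t m => smul_add _ _ _)
      (fun a s m => smul_comm _ _ _)
      (fun s m n => by rw [map_add, op_add, add_smul])
      (fun a s m => by rw [LinearMap.map_smul_of_tower, op_smul, smul_assoc]))
      (fun s a m => by
        rw [LinearMap.mk₂_apply, LinearMap.mk₂_apply, map_smul, smul_eq_mul, op_mul, mul_smul])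
  have hγ : ∀ i w, ι (γ i w) = op (c i (toModule M ι w)) := fun i w => by
    have : ι.restrictScalars k ∘ₗ γ i = (opLinearEquiv k).toLinearMap ∘ₗ
        (c i).restrictScalars k ∘ₗ toModule M ι := linearMap_ext fun s m => by
      simp [γ, toModule_tmul]
    exact LinearMap.congr_fun this w
  have hw : ∀ w, ∑ i, tmul k A (γ i w) (n i) = w := fun w => by
    have : ∑ i, mkRight k A M (n i) ∘ₗ γ i = LinearMap.id := linearMap_ext fun s m => by
      rw [LinearMap.sum_apply, LinearMap.id_apply]
      simp only [LinearMap.comp_apply, mkRight_apply, γ, lift_tmul, LinearMap.mk₂_apply,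
        smul_tmul]
      conv_rhs => rw [← hn m]
      exact (map_sum ((balancedRel k A S M).mkQ ∘ₗ TensorProduct.mk k S M s) _ _).symm
    have := LinearMap.congr_fun this w
    rwa [LinearMap.sum_apply] at this
  refine (injective_iff_map_eq_zero _).2 fun w h0 => ?_
  rw [← hw w]
  refine Finset.sum_eq_zero fun i _ => ?_
  have : γ i w = 0 := hι (by rw [hγ, h0, map_zero, map_zero, op_zero])
  rw [this, ← mkRight_apply, map_zero]

/-- Since `s` generates `S`, each `ι t` has the form `ι s * a`, so its image in `M` lies in `ι s ·
M`. -/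
theorem range_toModule (ι : S →ₗ[Aᵐᵒᵖ] Aᵐᵒᵖ) {s : S} (hs : ∀ t, ∃ a : Aᵐᵒᵖ, a • s = t) :
    LinearMap.range (toModule (k := k) M ι) =
      LinearMap.range (Module.toModuleEnd k (S := A) M (unop (ι s))) := by
  apply le_antisymm
  · have : (LinearMap.range (Module.toModuleEnd k (S := A) M (unop (ι s)))).mkQ ∘ₗ
        toModule (k := k) M ι = 0 := linearMap_ext fun t m => by
      obtain ⟨a, rfl⟩ := hs t
      refine (Submodule.Quotient.mk_eq_zero _).2 ⟨unop a • m, ?_⟩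
      rw [toModule_tmul, map_smul ι, smul_eq_mul, unop_mul, mul_smul]
      rfl
    rintro _ ⟨w, rfl⟩
    exact (Submodule.Quotient.mk_eq_zero _).1 (LinearMap.congr_fun this w)
  · rintro _ ⟨m, rfl⟩
    exact ⟨tmul k A s m, rfl⟩

variable {B : Type*} [Ring B] [Algebra k B] [Module Bᵐᵒᵖ M] [IsScalarTower k Bᵐᵒᵖ M]
  [SMulCommClass A Bᵐᵒᵖ M]

theorem finrank_range_toModuleEnd [Module.Finite A M] (hM : Module.Projective A M)
    {ι : S →ₗ[Aᵐᵒᵖ] Aᵐᵒᵖ} (hι : Function.Injective ι) {s : S}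
    (hs : ∀ t, ∃ a : Aᵐᵒᵖ, a • s = t) (b : Bᵐᵒᵖ) :
    Module.finrank k
        (LinearMap.range (Module.toModuleEnd k (S := Bᵐᵒᵖ) (BalancedTensor k A S M) b)) =
      Module.finrank k (LinearMap.range (Module.toModuleEnd k (S := Bᵐᵒᵖ) M b ∘ₗ
        Module.toModuleEnd k (S := A) M (unop (ι s)))) := by
  obtain ⟨d, n, c, hn⟩ := hM.exists_finite_dualBasis
  have hψ := toModule_injective (k := k) n c hn hι
  have hcomm : toModule (k := k) M ι ∘ₗ
      Module.toModuleEnd k (S := Bᵐᵒᵖ) (BalancedTensor k A S M) b =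
      Module.toModuleEnd k (S := Bᵐᵒᵖ) M b ∘ₗ toModule M ι := linearMap_ext fun t m =>
    smul_comm (unop (ι t)) b m
  rw [(Submodule.equivMapOfInjective _ hψ _).finrank_eq, ← LinearMap.range_comp, hcomm,
    LinearMap.range_comp, range_toModule ι hs, ← LinearMap.range_comp]

end BalancedTensor

/-! ### Projectivity of the dual bimodule. -/

namespace DualBimodule

variable {k B M : Type*} [Field k] [Ring B] [Algebra k B] [AddCommGroup M] [Module k M]
  [Module Bᵐᵒᵖ M] [IsScalarTower k Bᵐᵒᵖ M]

instance : IsScalarTower k B (DualBimodule k M) where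
  smul_assoc c b f := DualBimodule.ext fun m =>
    (congrArg f (smul_assoc c (op b) m)).trans (LinearMap.map_smul (M₂ := k) f c (op b • m))

instance {A : Type*} [Ring A] [Algebra k A] [Module A M] [IsScalarTower k A M] :
    IsScalarTower k Aᵐᵒᵖ (DualBimodule k M) where
  smul_assoc c a f := DualBimodule.ext fun m =>
    (congrArg f (smul_assoc c (unop a) m)).trans (LinearMap.map_smul (M₂ := k) f c (unop a • m))

instance [Module.Finite k M] : Module.Finite k (DualBimodule k M) :=
  inferInstanceAs (Module.Finite k (Module.Dual k M))

/-- Over a symmetric algebra, the dual of a finitely generated projective right module is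
projective. -/
theorem projective [Module.Finite Bᵐᵒᵖ M] (h : IsBimoduleSymmetric k B)
    (hM : Module.Projective Bᵐᵒᵖ M) : Module.Projective B (DualBimodule k M) := by
  obtain ⟨τ, hτ⟩ := h.exists_isSymmetrizingForm
  obtain ⟨d, n, c, hn⟩ := hM.exists_finite_dualBasis
  have key : ∀ (f : DualBimodule k M) (m : M) (b : B),
      τ (unop (hτ.op.dualHom (f : M →ₗ[k] k) m) * b) = f (op b • m) := fun f m b => by
    rw [hτ.map_mul_comm]
    exact hτ.op.dualHom_spec (f : M →ₗ[k] k) m (op b)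
  have hext : ∀ x y : B, (∀ r, τ (x * r) = τ (y * r)) → x = y := fun x y hxy =>
    sub_eq_zero.1 (hτ.eq_zero _ fun r => by rw [sub_mul, map_sub, hxy, sub_self])
  -- A dual basis of `M*` comes from `M* ≅ Hom_B(M, B)`: the coordinates of `f` are the values of
  -- its `B`-linear lift at the `n i`, and the generators are `τ ∘ c i`.
  let g : DualBimodule k M →ₗ[B] (Fin d → B) :=
    { toFun := fun f i => unop (hτ.op.dualHom (f : M →ₗ[k] k) (n i))
      map_add' := fun f f' => funext fun i => hext _ _ fun r => by
        rw [Pi.add_apply, add_mul, map_add, key, key, key]; rfl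
      map_smul' := fun b f => funext fun i => hext _ _ fun r => by
        rw [RingHom.id_apply, Pi.smul_apply, smul_eq_mul, mul_assoc, hτ.map_mul_comm b, mul_assoc,
          key, key, DualBimodule.smul_apply, ← mul_smul, op_mul] }
  let τc : Fin d → DualBimodule k M := fun i =>
    (τ ∘ₗ (opLinearEquiv k).symm.toLinearMap ∘ₗ (c i).restrictScalars k : M →ₗ[k] k)
  refine Module.Projective.of_split g (Fintype.linearCombination B τc) ?_
  refine LinearMap.ext fun f => DualBimodule.ext fun m => ?_
  rw [LinearMap.comp_apply, Fintype.linearCombination_apply, LinearMap.id_apply]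
  have h1 : (∑ i, g f i • τc i) m = ∑ i, (g f i • τc i) m :=
    LinearMap.sum_apply (M := M) (M₂ := k) _ _ _
  have h2 : f m = ∑ i, f (c i m • n i) := by
    conv_lhs => rw [← hn m]
    exact map_sum (show M →ₗ[k] k from f) _ _
  rw [h1, h2]
  refine Finset.sum_congr rfl fun i _ => ?_
  rw [← op_unop (c i m), ← key, hτ.map_mul_comm, DualBimodule.smul_apply]
  change τ (unop (c i (op (g f i) • m))) = _
  rw [map_smul, smul_eq_mul, unop_mul, unop_op]
  rfl

end DualBimodule
-- The symmetry of multiplicities.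
theorem theorem1p1 {k A B M S T PS PT : Type*}
    [Field k] [IsAlgClosed k]
    [Ring A] [Algebra k A] [Module.Finite k A]
    [Ring B] [Algebra k B] [Module.Finite k B]
    (hA : IsBimoduleSymmetric k A) (hB : IsBimoduleSymmetric k B)
    -- an `(A, B)`-bimodule `M`
    [AddCommGroup M] [Module k M] [Module.Finite k M]
    [Module A M] [IsScalarTower k A M] [Module Bᵐᵒᵖ M] [IsScalarTower k Bᵐᵒᵖ M]
    [SMulCommClass A Bᵐᵒᵖ M]
    (hAM : Module.Projective A M) (hMB : Module.Projective Bᵐᵒᵖ M)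
    -- a simple right `A`-module `S` and its projective cover `PS`
    [AddCommGroup S] [Module k S] [Module Aᵐᵒᵖ S] [IsScalarTower k Aᵐᵒᵖ S]
    (hS : IsSimpleModule Aᵐᵒᵖ S)
    [AddCommGroup PS] [Module Aᵐᵒᵖ PS] (πS : PS →ₗ[Aᵐᵒᵖ] S) (hπS : IsProjectiveCover πS)
    -- a simple right `B`-module `T` and its projective cover `PT`
    [AddCommGroup T] [Module k T] [Module Bᵐᵒᵖ T] [IsScalarTower k Bᵐᵒᵖ T]
    (hT : IsSimpleModule Bᵐᵒᵖ T)
    [AddCommGroup PT] [Module Bᵐᵒᵖ PT] (πT : PT →ₗ[Bᵐᵒᵖ] T) (hπT : IsProjectiveCover πT) :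
    summandMultiplicity Bᵐᵒᵖ PT (BalancedTensor k A S M) ≠ ⊤ ∧
    summandMultiplicity Bᵐᵒᵖ PT (BalancedTensor k A S M) =
      summandMultiplicity Aᵐᵒᵖ PS (BalancedTensor k B T (DualBimodule k M)) := by
  obtain ⟨τA, hτA⟩ := hA.exists_isSymmetrizingForm
  obtain ⟨τB, hτB⟩ := hB.exists_isSymmetrizingForm
  have : Module.Finite A M := Module.Finite.of_restrictScalars_finite k A M
  have : Module.Finite Bᵐᵒᵖ M := Module.Finite.of_restrictScalars_finite k Bᵐᵒᵖ M
  have : Module.Finite B (DualBimodule k M) :=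
    Module.Finite.of_restrictScalars_finite k B (DualBimodule k M)
  have := IsSimpleModule.nontrivial Aᵐᵒᵖ S
  have := IsSimpleModule.nontrivial Bᵐᵒᵖ T
  have : Module.Finite k S := Module.Finite.trans Aᵐᵒᵖ S
  have : Module.Finite k T := Module.Finite.trans Bᵐᵒᵖ T
  -- The covers carry no `k`-structure of their own; it is restricted from the algebra.
  let _ : Module k PS := Module.compHom PS (algebraMap k Aᵐᵒᵖ)
  have : IsScalarTower k Aᵐᵒᵖ PS := IsScalarTower.of_algebraMap_smul fun _ _ => rfl
  let _ : Module k PT := Module.compHom PT (algebraMap k Bᵐᵒᵖ)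
  have : IsScalarTower k Bᵐᵒᵖ PT := IsScalarTower.of_algebraMap_smul fun _ _ => rfl
  obtain ⟨s, hs⟩ := exists_ne (0 : S)
  obtain ⟨t, ht⟩ := exists_ne (0 : T)
  obtain ⟨θS, hθS⟩ := exists_ne (0 : S →ₗ[k] k)
  obtain ⟨θT, hθT⟩ := exists_ne (0 : T →ₗ[k] k)
  rw [hπT.summandMultiplicity_eq_finrank hτB.op hθT ht,
    hπS.summandMultiplicity_eq_finrank hτA.op hθS hs,
    BalancedTensor.finrank_range_toModuleEnd hAM (hτA.op.dualHom_injective hθS)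
      (IsSimpleModule.toSpanSingleton_surjective Aᵐᵒᵖ hs),
    BalancedTensor.finrank_range_toModuleEnd (DualBimodule.projective hB hMB)
      (hτB.op.dualHom_injective hθT) (IsSimpleModule.toSpanSingleton_surjective Bᵐᵒᵖ ht)]
  refine ⟨ENat.natCast_ne_top _, congrArg _ ?_⟩
  -- The actions of `z_T` and `z_S` on `M*` compose, by definition, to the transpose of `m ↦ z_S m
  -- z_T`.
  exact (LinearMap.finrank_range_dualMap_eq_finrank_range
    (Module.toModuleEnd k (S := Bᵐᵒᵖ) M (hτB.op.dualHom θT t) ∘ₗ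
      Module.toModuleEnd k (S := A) M (unop (hτA.op.dualHom θS s)))).symm
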